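/- Let $\mathbb K\in\{\mathbb R,\mathbb C\}$, let $V$ be a finite-dimensional $\mathbb K$-vector space, fix $1\in V$, and let $m:V\times V\to V$ be an associative bilinear multiplication with two-sided unit $1$. Let $\mathcal A$ be the set of all associative bilinear multiplications on $V$ and $\mathcal A_1\subset\mathcal A$ the subset of those having $1$ as two-sided unit, both with the subspace topology of the finite-dimensional vector space of bilinear maps $V\times V\to V$. The group $GL(V)$ acts on bilinear maps by $(g\cdot m')(x,y)=g\,m'(g^{-1}x,g^{-1}y)$. Let $GL(V)_0$ be the connected component of the identity of $GL(V)$, and $GL(V,1)_0$ the connected component of the identity of the group $GL(V,1)=\{g\in GL(V): g(1)=1\}$. Then: (i) There is a neighborhood of $m$ in $\mathcal A$ such that every $m'$ in it has a two-sided unit, and for every such $m'$ there is $g\in GL(V)_0$ such that $g\cdot m'$ has unit $1$. (ii) The map of quotient spaces (with the quotient topologies) $$F:\ \mathcal A_1/GL(V,1)_0\ \longrightarrow\ \mathcal A/GL(V)_0$$ induced by the inclusion $\mathcal A_1\subset\mathcal A$ is a local bijection at the class of $m$: for every neighborhood $N$ of $[m]$ in $\mathcal A_1/GL(V,1)_0$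 there are an open neighborhood $U\subset N$ of $[m]$ and an open neighborhood $W$ of $[m]$ in $\mathcal A/GL(V)_0$ such that $F$ restricts to a bijection $U\to W$. -/

import Mathlib

open Topology

noncomputable section

namespace AlgStr

section Defs

variable (𝕜 : Type*) [RCLike 𝕜] (V : Type*) [NormedAddCommGroup V] [NormedSpace 𝕜 V]

/-- Bilinear maps `V × V → V`, with their vector space topology. (For finite-dimensional `V` every
bilinear map is continuous, and the topology does not depend on the norm of `V`.) -/
abbrev Bilin : Type _ := V →L[𝕜] V →L[𝕜] V

/-- The topological group `GL(V)` of linear automorphisms of `V`. -/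
abbrev GLin : Type _ := (V →L[𝕜] V)ˣ

variable {𝕜 V}

/-- Associativity of a multiplication. -/
def IsAssoc (m : Bilin 𝕜 V) : Prop := ∀ x y z : V, m (m x y) z = m x (m y z)

/-- The vector `e` is a two-sided unit of the multiplication `m`. -/
def HasUnit (m : Bilin 𝕜 V) (e : V) : Prop := ∀ x : V, m e x = x ∧ m x e = x

/-- Transport of a multiplication along `g`: `(g • m)(x, y) = g (m (g⁻¹ x, g⁻¹ y))`. -/
def transport (g : GLin 𝕜 V) (m : Bilin 𝕜 V) : Bilin 𝕜 V :=
  (ContinuousLinearMap.compL 𝕜 V V V (g : V →L[𝕜] V)).comp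
    (m.bilinearComp ((g⁻¹ : GLin 𝕜 V) : V →L[𝕜] V) ((g⁻¹ : GLin 𝕜 V) : V →L[𝕜] V))

theorem transport_apply (g : GLin 𝕜 V) (m : Bilin 𝕜 V) (x y : V) :
    transport g m x y = (g : V →L[𝕜] V)
      (m (((g⁻¹ : GLin 𝕜 V) : V →L[𝕜] V) x) (((g⁻¹ : GLin 𝕜 V) : V →L[𝕜] V) y)) := rfl

theorem transport_one (m : Bilin 𝕜 V) : transport (1 : GLin 𝕜 V) m = m := by
  ext x y
  simp [transport_apply]

theorem transport_mul (g h : GLin 𝕜 V) (m : Bilin 𝕜 V) :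
    transport (g * h) m = transport g (transport h m) := by
  ext x y
  simp [transport_apply]

variable (𝕜 V)

/-- The space of associative algebra structures on `V`. -/
abbrev Assoc : Type _ := {m : Bilin 𝕜 V // IsAssoc m}

variable {V}

/-- The space of associative algebra structures on `V` with unit the fixed vector `e`. -/
abbrev Unital (e : V) : Type _ := {m : Bilin 𝕜 V // IsAssoc m ∧ HasUnit m e}

variable {𝕜}

/-- Forget that `e` is a unit. -/
def Unital.toAssoc {e : V} (m : Unital 𝕜 e) : Assoc 𝕜 V := ⟨m.1, m.2.1⟩

variable (𝕜 V)

/-- The connected component of the identity in `GL(V)`. -/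
def glZero : Subgroup (GLin 𝕜 V) := Subgroup.connectedComponentOfOne (GLin 𝕜 V)

variable {V}

/-- The group of linear automorphisms of `V` that fix `e`. -/
def fixing (e : V) : Subgroup (GLin 𝕜 V) where
  carrier := {g | (g : V →L[𝕜] V) e = e}
  one_mem' := by simp
  mul_mem' {a b} ha hb := by
    simp only [Set.mem_ofPred_eq] at ha hb ⊢
    simp [ha, hb]
  inv_mem' {a} ha := by
    simp only [Set.mem_ofPred_eq] at ha ⊢
    conv_lhs => rw [← ha]
    rw [← mul_apply_eq_comp, Units.inv_mul, one_apply_eq_self]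

/-- The connected component of the identity in the group of linear automorphisms fixing `e`,
taken in that group (with its subspace topology). -/
def fixingZero (e : V) : Subgroup (fixing 𝕜 e) := Subgroup.connectedComponentOfOne (fixing 𝕜 e)

variable (V)

/-- Associative structures are equivalent when an element of `GL(V)₀` carries one to the other. -/
def assocSetoid : Setoid (Assoc 𝕜 V) where
  r m m' := ∃ g ∈ glZero 𝕜 V, transport g m.1 = m'.1
  iseqv :=
    { refl := fun m => ⟨1, one_mem _, transport_one _⟩
      symm := fun {m m'} ⟨g, hg, h⟩ => ⟨g⁻¹, inv_mem hg, by
        rw [← h, ← transport_mul, inv_mul_cancel, transport_one]⟩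
      trans := fun {m m' m''} ⟨g, hg, h⟩ ⟨g', hg', h'⟩ => ⟨g' * g, mul_mem hg' hg, by
        rw [transport_mul, h, h']⟩ }

variable {V}

/-- Structures with unit `e` are equivalent when an element of `GL(V, e)₀` carries one to the
other. -/
def unitalSetoid (e : V) : Setoid (Unital 𝕜 e) where
  r m m' := ∃ g ∈ fixingZero 𝕜 e, transport (g : GLin 𝕜 V) m.1 = m'.1
  iseqv :=
    { refl := fun m => ⟨1, one_mem _, transport_one _⟩
      symm := fun {m m'} ⟨g, hg, h⟩ => ⟨g⁻¹, inv_mem hg, by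
        rw [← h, ← transport_mul, ← Subgroup.coe_mul, inv_mul_cancel, Subgroup.coe_one,
          transport_one]⟩
      trans := fun {m m' m''} ⟨g, hg, h⟩ ⟨g', hg', h'⟩ => ⟨g' * g, mul_mem hg' hg, by
        rw [Subgroup.coe_mul, transport_mul, h, h']⟩ }

variable (V)

/-- Associative structures on `V` modulo `GL(V)₀`, with the quotient topology. -/
abbrev AssocClass : Type _ := Quotient (assocSetoid 𝕜 V)

variable {V}

/-- Associative structures on `V` with unit `e` modulo `GL(V, e)₀`, with the quotient topology. -/
abbrev UnitalClass (e : V) : Type _ := Quotient (unitalSetoid 𝕜 e)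

variable {𝕜}

theorem fixingZero_le {e : V} {g : fixing 𝕜 e} (hg : g ∈ fixingZero 𝕜 e) :
    (g : GLin 𝕜 V) ∈ glZero 𝕜 V :=
  Continuous.image_connectedComponent_subset
    (f := fun h : fixing 𝕜 e => (h : GLin 𝕜 V)) continuous_subtype_val 1 ⟨g, hg, rfl⟩

variable (𝕜)

/-- The map on equivalence classes induced by the inclusion of the structures with unit `e` into
all associative structures. -/
def forgetUnit (e : V) : UnitalClass 𝕜 e → AssocClass 𝕜 V :=
  Quotient.map Unital.toAssoc fun _ _ ⟨g, hg, h⟩ => ⟨(g : GLin 𝕜 V), fixingZero_le hg, h⟩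

end Defs

end AlgStr

end

/-!
Near `m`, the unit of an associative structure `m'` exists and depends continuously on `m'`: left
multiplication by `e` is invertible for `m` (it is the identity), hence for `m'` near `m`, and
associativity makes the solution `e'` of `m' e e' = e` a left unit; the mirror argument gives a
right unit, and the two agree (`IsAssoc.hasUnit_inverse`). An explicit rank-one perturbation of the
identity, depending continuously on `m'`, carries `e'` back to `e`. It is close to `1`, hence in
`GL(V)₀`, which is open. So every `m'` near `m` is moved by `GL(V)₀` to a structure with unit `e` as
close to `m` as desired (`eventually_exists_transport`). This proves the first assertion, and also
that `forgetUnit` is an open map (`isOpenMap_forgetUnit`).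

The map `forgetUnit` is moreover injective (`forgetUnit_injective`). If `g ∈ GL(V)₀` carries one
structure with unit `e` to another, then `g e = e`, and what is needed is that
`GL(V)₀ ∩ GL(V, e) = GL(V, e)₀` (`mem_fixingZero_of_mem_glZero`). To see this, `g` is multiplied by
transvections fixing `e`, each joined to `1` inside `GL(V, e)` by a segment, until it fixes a
hyperplane `W ∋ e` pointwise. It is then a rank-one perturbation of the identity determined by a
vector `a`, with determinant `1 + f a` for a functional `f` with kernel `W`. Since `g ∈ GL(V)₀`,
this determinant lies in the component of `1` in `𝕜ˣ`, and the `a` with that property form a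
connected set containing `0`. The argument is the same over `ℝ` and `ℂ`.

An injective open map restricts to a bijection from any open set onto an open set, whence the second
assertion.
-/

noncomputable section

namespace AlgStr

variable {𝕜 : Type*} [RCLike 𝕜] {V : Type*} [NormedAddCommGroup V] [NormedSpace 𝕜 V]

/-! ### Units and transport -/

theorem HasUnit.eq {m : Bilin 𝕜 V} {e e' : V} (h : HasUnit m e) (h' : HasUnit m e') : e = e' :=
  (h' e).2.symm.trans (h e').1

theorem GLin.apply_inv_apply (g : GLin 𝕜 V) (x : V) :
    (g : V →L[𝕜] V) (((g⁻¹ : GLin 𝕜 V) : V →L[𝕜] V) x) = x :=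
  DFunLike.congr_fun g.mul_inv x

theorem GLin.inv_apply_apply (g : GLin 𝕜 V) (x : V) :
    ((g⁻¹ : GLin 𝕜 V) : V →L[𝕜] V) ((g : V →L[𝕜] V) x) = x :=
  DFunLike.congr_fun g.inv_mul x

theorem HasUnit.transport {m : Bilin 𝕜 V} {e : V} (h : HasUnit m e) (g : GLin 𝕜 V) :
    HasUnit (transport g m) ((g : V →L[𝕜] V) e) := fun x => by
  simp [transport_apply, GLin.inv_apply_apply, GLin.apply_inv_apply, (h _).1, (h _).2]

theorem IsAssoc.transport {m : Bilin 𝕜 V} (h : IsAssoc m) (g : GLin 𝕜 V) :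
    IsAssoc (transport g m) := fun x y z => by
  simp only [transport_apply, GLin.inv_apply_apply, h _ _ _]

/-- If left and right multiplication by `e` are invertible, then the solution `e'` of `e * e' = e`
is a two-sided unit: cancelling `e` in `e * (e' * x) = e * x` shows that it is a left unit, and the
solution of `e'' * e = e` is likewise a right unit. -/
theorem IsAssoc.hasUnit_inverse {m : Bilin 𝕜 V} (h : IsAssoc m) {e : V} (hl : IsUnit (m e))
    (hr : IsUnit (m.flip e)) : HasUnit m (Ring.inverse (m e) e) := by
  have hla : m e (Ring.inverse (m e) e) = e := DFunLike.congr_fun (Ring.mul_inverse_cancel _ hl) e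
  have hra : m (Ring.inverse (m.flip e) e) e = e :=
    DFunLike.congr_fun (Ring.mul_inverse_cancel _ hr) e
  set a := Ring.inverse (m e) e
  set b := Ring.inverse (m.flip e) e
  have injl : Function.Injective (m e) := fun x y hxy => by
    have := congrArg (Ring.inverse (m e) : V →L[𝕜] V) hxy
    have key : ∀ z, Ring.inverse (m e) (m e z) = z :=
      fun z => DFunLike.congr_fun (Ring.inverse_mul_cancel _ hl) z
    rwa [key, key] at this
  have injr : Function.Injective (m.flip e) := fun x y hxy => by
    have := congrArg (Ring.inverse (m.flip e) : V →L[𝕜] V) hxy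
    have key : ∀ z, Ring.inverse (m.flip e) (m.flip e z) = z :=
      fun z => DFunLike.congr_fun (Ring.inverse_mul_cancel _ hr) z
    rwa [key, key] at this
  have ha : ∀ x, m a x = x := fun x => injl (by rw [← h, hla])
  have hb : ∀ x, m x b = x := fun x => injr (by
    rw [ContinuousLinearMap.flip_apply, ContinuousLinearMap.flip_apply, h, hra])
  have hab : a = b := (hb a).symm.trans (ha b)
  exact fun x => ⟨ha x, hab ▸ hb x⟩

/-! ### The identity component of `GL(V)` -/

/-- The determinant maps `GL(V)₀` into the component of `1` in `𝕜ˣ`. -/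
theorem det_mem_of_mem_glZero {g : GLin 𝕜 V} (hg : g ∈ glZero 𝕜 V) :
    ∃ c ∈ connectedComponent (1 : 𝕜ˣ), (c : 𝕜) = (g : V →L[𝕜] V).det := by
  let d : (V →L[𝕜] V) →* 𝕜 :=
    LinearMap.det.comp (ContinuousLinearMap.toLinearMapRingHom : (V →L[𝕜] V) →+* _).toMonoidHom
  have hd : Continuous d := ContinuousLinearMap.continuous_det
  have h := (hd.units_map d).image_connectedComponent_subset 1 ⟨g, hg, rfl⟩
  rw [map_one] at h
  exact ⟨_, h, rfl⟩

variable [FiniteDimensional 𝕜 V]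

theorem glZero_mem_nhds_one : (glZero 𝕜 V : Set (GLin 𝕜 V)) ∈ 𝓝 1 := by
  have : CompleteSpace V := FiniteDimensional.complete 𝕜 V
  let _ : NormedSpace ℝ (V →L[𝕜] V) := NormedSpace.restrictScalars ℝ 𝕜 (V →L[𝕜] V)
  have : LocallyConnectedSpace (GLin 𝕜 V) :=
    (Units.isOpenEmbedding_val (R := V →L[𝕜] V)).locallyConnectedSpace
  exact isOpen_connectedComponent.mem_nhds mem_connectedComponent

/-! ### The identity component of `GL(V, e)` -/

theorem det_one_add_smulRight (f : V →L[𝕜] 𝕜) (a : V) :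
    (1 + f.smulRight a : V →L[𝕜] V).det = 1 + f a :=
  LinearMap.transvection.det (f : V →ₗ[𝕜] 𝕜) a

theorem isUnit_one_add_smulRight {f : V →L[𝕜] 𝕜} {a : V} (h : 1 + f a ≠ 0) :
    IsUnit (1 + f.smulRight a : V →L[𝕜] V) := by
  have : CompleteSpace V := FiniteDimensional.complete 𝕜 V
  rw [ContinuousLinearMap.isUnit_iff_isUnit_toLinearMap, LinearMap.isUnit_iff_isUnit_det]
  exact isUnit_iff_ne_zero.2 ((det_one_add_smulRight f a).trans_ne h)

theorem isEmbedding_coe_fixing (e : V) :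
    IsEmbedding fun g : fixing 𝕜 e => ((g : GLin 𝕜 V) : V →L[𝕜] V) :=
  have : CompleteSpace V := FiniteDimensional.complete 𝕜 V
  Units.isOpenEmbedding_val.isEmbedding.comp IsEmbedding.subtypeVal

/-- A connected family of rank-one perturbations of the identity, fixing `e` and containing the
identity, stays in `GL(V, e)₀`. -/
theorem mem_fixingZero_of_isPreconnected {e : V} {f : V →L[𝕜] 𝕜} (hf : f e = 0) {S : Set V}
    (hS : IsPreconnected S) (h0 : 0 ∈ S) (hne : ∀ a ∈ S, 1 + f a ≠ 0) {g : fixing 𝕜 e} {a : V}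
    (ha : a ∈ S) (hg : ((g : GLin 𝕜 V) : V →L[𝕜] V) = 1 + f.smulRight a) :
    g ∈ fixingZero 𝕜 e := by
  let T : Set (fixing 𝕜 e) :=
    {g | ∃ a ∈ S, ((g : GLin 𝕜 V) : V →L[𝕜] V) = 1 + f.smulRight a}
  have hT : IsPreconnected T := by
    rw [← (isEmbedding_coe_fixing e).isInducing.isPreconnected_image]
    have himg : (fun g : fixing 𝕜 e => ((g : GLin 𝕜 V) : V →L[𝕜] V)) '' T =
        (fun a => 1 + f.smulRight a) '' S := by
      ext u
      constructor
      · rintro ⟨g, ⟨a, ha, hg⟩, rfl⟩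
        exact ⟨a, ha, hg.symm⟩
      · rintro ⟨a, ha, rfl⟩
        obtain ⟨u, hu⟩ := isUnit_one_add_smulRight (hne a ha)
        refine ⟨⟨u, ?_⟩, ⟨a, ha, hu⟩, hu⟩
        change (u : V →L[𝕜] V) e = e
        simp [hu, hf]
    rw [himg]
    refine hS.image _ (Continuous.continuousOn ?_)
    refine continuous_clm_apply.2 fun x => ?_
    simp only [add_apply, ContinuousLinearMap.smulRight_apply]
    fun_prop
  exact hT.subset_connectedComponent (x := 1) ⟨0, h0, by simp⟩ ⟨a, ha, hg⟩

/-- Vectors independent modulo `W ∋ e` are exchanged by a transvection fixing `W` pointwise, and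
transvections fixing `e` lie in `GL(V, e)₀`. -/
theorem exists_fixingZero_apply_eq {e : V} {W : Submodule 𝕜 V} (he : e ∈ W) {x y : V}
    (hx : x ∉ W) (hy : y ∉ W ⊔ 𝕜 ∙ x) :
    ∃ h ∈ fixingZero 𝕜 e, (∀ w ∈ W, ((h : GLin 𝕜 V) : V →L[𝕜] V) w = w) ∧
      ((h : GLin 𝕜 V) : V →L[𝕜] V) x = y := by
  have hx' : x ∉ W ⊔ 𝕜 ∙ (y - x) := by
    intro hmem
    obtain ⟨w, hw, z, hz, hwz⟩ := Submodule.mem_sup.1 hmem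
    obtain ⟨c, rfl⟩ := Submodule.mem_span_singleton.1 hz
    by_cases hc : c = 0
    · subst hc
      exact hx (by rw [← hwz]; simpa using hw)
    · refine hy (Submodule.mem_sup.2 ⟨-c⁻¹ • w, W.smul_mem _ hw, (1 + c⁻¹) • x,
        Submodule.mem_span_singleton.2 ⟨_, rfl⟩, ?_⟩)
      have h1 : c⁻¹ • x = c⁻¹ • w + (y - x) := by
        conv_lhs => rw [← hwz]
        rw [smul_add, smul_smul, inv_mul_cancel₀ hc, one_smul]
      rw [add_smul, h1, one_smul, neg_smul]
      abel
  obtain ⟨f₀, hf₀x, hf₀⟩ := Submodule.exists_le_ker_of_notMem hx'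
  let f : V →L[𝕜] 𝕜 := LinearMap.toContinuousLinearMap ((f₀ x)⁻¹ • f₀)
  have hfx : f x = 1 := by simp [f, hf₀x]
  have hfW : ∀ w ∈ W, f w = 0 := fun w hw => by
    have : f₀ w = 0 := hf₀ (Submodule.mem_sup_left hw)
    simp [f, this]
  have hfa : f (y - x) = 0 := by
    have : f₀ (y - x) = 0 :=
      hf₀ (Submodule.mem_sup_right (Submodule.mem_span_singleton_self _))
    simp only [f, LinearMap.coe_toContinuousLinearMap', LinearMap.smul_apply, this, smul_zero]
  obtain ⟨u, hu⟩ := isUnit_one_add_smulRight (f := f) (a := y - x) (by simp [hfa])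
  have hue : (u : V →L[𝕜] V) e = e := by simp [hu, hfW e he]
  have hker : IsPreconnected ((f : V →ₗ[𝕜] 𝕜).ker : Set V) := by
    let _ : NormedSpace ℝ V := NormedSpace.restrictScalars ℝ 𝕜 V
    have : IsScalarTower ℝ 𝕜 V := RestrictScalars.isScalarTower ℝ 𝕜 V
    exact (((f : V →ₗ[𝕜] 𝕜).ker.restrictScalars ℝ).convex).isPreconnected
  refine ⟨⟨u, hue⟩, mem_fixingZero_of_isPreconnected (hfW e he) hker (Submodule.zero_mem _)
    (fun a ha => ?_) (a := y - x) hfa hu, fun w hw => ?_, ?_⟩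
  · have : f a = 0 := ha
    simp [this]
  · simp [hu, hfW w hw]
  · simp [hu, hfx]

/-- If `v'` and `v` are dependent modulo `W`, two transvections are used, passing through a
vector outside `W ⊔ 𝕜 ∙ v`. -/
theorem exists_fixingZero_apply_eq_of_sup_ne_top {e : V} {W : Submodule 𝕜 V} (he : e ∈ W)
    {v v' : V} (hv : v ∉ W) (hv' : v' ∉ W) (htop : W ⊔ 𝕜 ∙ v ≠ ⊤) :
    ∃ h ∈ fixingZero 𝕜 e, (∀ w ∈ W, ((h : GLin 𝕜 V) : V →L[𝕜] V) w = w) ∧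
      ((h : GLin 𝕜 V) : V →L[𝕜] V) v = v' := by
  by_cases hmem : v' ∈ W ⊔ 𝕜 ∙ v
  · obtain ⟨u, hu⟩ : ∃ u, u ∉ W ⊔ 𝕜 ∙ v := by
      by_contra! H
      exact htop (eq_top_iff.2 fun x _ => H x)
    have hu' : u ∉ W ⊔ 𝕜 ∙ v' := fun h => hu
      (sup_le le_sup_left ((Submodule.span_singleton_le_iff_mem _ _).2 hmem) h)
    obtain ⟨h₁, hh₁, hW₁, hv₁⟩ := exists_fixingZero_apply_eq he hv hu
    obtain ⟨h₂, hh₂, hW₂, hv₂⟩ := exists_fixingZero_apply_eq he hv' hu'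
    have hinv : ∀ x y : V, ((h₂ : GLin 𝕜 V) : V →L[𝕜] V) x = y →
        (((h₂ : GLin 𝕜 V)⁻¹ : GLin 𝕜 V) : V →L[𝕜] V) y = x := by
      rintro x _ rfl
      exact GLin.inv_apply_apply _ _
    refine ⟨h₂⁻¹ * h₁, mul_mem (inv_mem hh₂) hh₁, fun w hw => ?_, ?_⟩
    · simp [hW₁ w hw, hinv _ _ (hW₂ w hw)]
    · simp [hv₁, hinv _ _ hv₂]
  · exact exists_fixingZero_apply_eq he hv hmem

/-- The case of an element fixing a hyperplane: such elements form a family of rank-one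
perturbations of the identity, connected once the determinant is confined to the component of `1`
in `𝕜ˣ`. -/
theorem mem_fixingZero_of_fixes_hyperplane {e : V} {g : fixing 𝕜 e}
    (hg : (g : GLin 𝕜 V) ∈ glZero 𝕜 V) {W : Submodule 𝕜 V} (he : e ∈ W)
    (hW : ∀ w ∈ W, ((g : GLin 𝕜 V) : V →L[𝕜] V) w = w) {v : V} (hv : v ∉ W)
    (htop : W ⊔ 𝕜 ∙ v = ⊤) : g ∈ fixingZero 𝕜 e := by
  obtain ⟨f₀, hf₀v, hf₀⟩ := Submodule.exists_le_ker_of_notMem hv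
  let f : V →L[𝕜] 𝕜 := LinearMap.toContinuousLinearMap ((f₀ v)⁻¹ • f₀)
  have hfv : f v = 1 := by simp [f, hf₀v]
  have hfW : ∀ w ∈ W, f w = 0 := fun w hw => by
    have : f₀ w = 0 := hf₀ hw
    simp [f, this]
  set G : V →L[𝕜] V := ((g : GLin 𝕜 V) : V →L[𝕜] V) with hG
  have hGa : G = 1 + f.smulRight (G v - v) := by
    ext x
    have hx : x ∈ W ⊔ 𝕜 ∙ v := htop ▸ Submodule.mem_top
    refine LinearMap.eqOn_sup (f := G) (g := 1 + f.smulRight (G v - v)) (S := W) (T := 𝕜 ∙ v)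
      (fun w hw => ?_) (fun z hz => ?_) hx
    · simp [hW w hw, hfW w hw]
    · obtain ⟨c, rfl⟩ := Submodule.mem_span_singleton.1 hz
      simp [hfv]
  have hdet : G.det = 1 + f (G v - v) := by
    rw [← det_one_add_smulRight, ← hGa]
  obtain ⟨c, hc, hcG⟩ := det_mem_of_mem_glZero hg
  let S : Set V := (fun p : 𝕜ˣ × V => ((p.1 : 𝕜) - 1) • v + (p.2 - f p.2 • v)) ''
    (connectedComponent (1 : 𝕜ˣ) ×ˢ Set.univ)
  have hS : IsPreconnected S := by
    let _ : NormedSpace ℝ V := NormedSpace.restrictScalars ℝ 𝕜 V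
    refine (isPreconnected_connectedComponent.prod isPreconnected_univ).image _
      (Continuous.continuousOn ?_)
    have : Continuous fun p : 𝕜ˣ × V => (p.1 : 𝕜) := Units.continuous_val.comp continuous_fst
    fun_prop
  refine mem_fixingZero_of_isPreconnected (hfW e he) hS
    ⟨(1, 0), ⟨mem_connectedComponent, trivial⟩, by simp⟩ ?_ (a := G v - v)
    ⟨(c, G v - v), ⟨hc, trivial⟩, ?_⟩ hGa
  · rintro _ ⟨⟨c, x⟩, -, rfl⟩
    simp [hfv]
  · simp only [hcG, ← hG, hdet]
    module

/-- Induction on the codimension of a subspace `W ∋ e` fixed pointwise by `g`. -/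
theorem mem_fixingZero_of_fixes {e : V} (n : ℕ) : ∀ {g : fixing 𝕜 e},
    (g : GLin 𝕜 V) ∈ glZero 𝕜 V → ∀ W : Submodule 𝕜 V, e ∈ W →
    (∀ w ∈ W, ((g : GLin 𝕜 V) : V →L[𝕜] V) w = w) →
    Module.finrank 𝕜 V ≤ Module.finrank 𝕜 W + n → g ∈ fixingZero 𝕜 e := by
  induction n with
  | zero =>
    intro g _ W _ hW hn
    have htop : W = ⊤ := Submodule.eq_top_of_finrank_eq (le_antisymm W.finrank_le hn)
    have : g = 1 := by
      ext x
      exact hW x (htop ▸ Submodule.mem_top)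
    exact this ▸ one_mem _
  | succ n ih =>
    intro g hg W he hW hn
    by_cases hWtop : W = ⊤
    · exact ih hg W he hW (by rw [hWtop, finrank_top]; omega)
    obtain ⟨v, hv⟩ : ∃ v, v ∉ W := by
      by_contra! H
      exact hWtop (eq_top_iff.2 fun x _ => H x)
    by_cases htop : W ⊔ 𝕜 ∙ v = ⊤
    · exact mem_fixingZero_of_fixes_hyperplane hg he hW hv htop
    have hgv : ((g : GLin 𝕜 V) : V →L[𝕜] V) v ∉ W := fun h => hv (by
      have h1 := hW _ h
      have h2 := congrArg (((g : GLin 𝕜 V)⁻¹ : GLin 𝕜 V) : V →L[𝕜] V) h1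
      rw [GLin.inv_apply_apply, GLin.inv_apply_apply] at h2
      rwa [h2] at h)
    obtain ⟨h, hh, hhW, hhv⟩ := exists_fixingZero_apply_eq_of_sup_ne_top he hv hgv htop
    have hinv : ∀ x y : V, ((h : GLin 𝕜 V) : V →L[𝕜] V) x = y →
        (((h : GLin 𝕜 V)⁻¹ : GLin 𝕜 V) : V →L[𝕜] V) y = x := by
      rintro x _ rfl
      exact GLin.inv_apply_apply _ _
    have hlt : W < W ⊔ 𝕜 ∙ v := lt_of_le_of_ne le_sup_left fun heq =>
      hv (heq ▸ Submodule.mem_sup_right (Submodule.mem_span_singleton_self v))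
    have hrank := Submodule.finrank_lt_finrank_of_lt hlt
    have key : h⁻¹ * g ∈ fixingZero 𝕜 e := by
      refine ih (mul_mem (inv_mem (fixingZero_le hh)) hg) (W ⊔ 𝕜 ∙ v) (hlt.le he) ?_ (by omega)
      refine fun x hx => LinearMap.eqOn_sup
        (f := ((((h⁻¹ * g : fixing 𝕜 e)) : GLin 𝕜 V) : V →L[𝕜] V)) (g := (1 : V →L[𝕜] V))
        (S := W) (T := 𝕜 ∙ v) (fun w hw => ?_) (fun z hz => ?_) hx
      · simp [hW w hw, hinv _ _ (hhW w hw)]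
      · obtain ⟨c, rfl⟩ := Submodule.mem_span_singleton.1 hz
        simp [hinv _ _ hhv]
    simpa using mul_mem hh key

/-- `GL(V)₀ ∩ GL(V, e) = GL(V, e)₀`. -/
theorem mem_fixingZero_of_mem_glZero {e : V} {g : fixing 𝕜 e}
    (hg : (g : GLin 𝕜 V) ∈ glZero 𝕜 V) : g ∈ fixingZero 𝕜 e := by
  refine mem_fixingZero_of_fixes (Module.finrank 𝕜 V) hg (𝕜 ∙ e)
    (Submodule.mem_span_singleton_self e) (fun w hw => ?_) (by omega)
  obtain ⟨c, rfl⟩ := Submodule.mem_span_singleton.1 hw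
  have : ((g : GLin 𝕜 V) : V →L[𝕜] V) e = e := g.2
  simp [this]

theorem forgetUnit_injective (e : V) : Function.Injective (forgetUnit 𝕜 e) := by
  intro a b
  induction a, b using Quotient.inductionOn₂ with
  | _ m₁ m₂ =>
    intro h
    obtain ⟨g, hg, h⟩ := Quotient.exact h
    have hge : (g : V →L[𝕜] V) e = e := by
      have h1 := m₁.2.2.transport g
      rw [show transport g m₁.1 = m₂.1 from h] at h1
      exact h1.eq m₂.2.2
    exact Quotient.sound ⟨⟨g, hge⟩, mem_fixingZero_of_mem_glZero hg, h⟩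

/-! ### Structures near a unital one -/

theorem continuous_transport :
    Continuous fun p : GLin 𝕜 V × Bilin 𝕜 V => transport p.1 p.2 := by
  refine continuous_clm_apply.2 fun x => continuous_clm_apply.2 fun y => ?_
  have h : Continuous fun p : GLin 𝕜 V × Bilin 𝕜 V => ((p.1 : GLin 𝕜 V) : V →L[𝕜] V) :=
    Units.continuous_val.comp continuous_fst
  have h' : Continuous fun p : GLin 𝕜 V × Bilin 𝕜 V => ((p.1⁻¹ : GLin 𝕜 V) : V →L[𝕜] V) :=
    Units.continuous_val.comp (continuous_inv.comp continuous_fst)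
  exact h.clm_apply ((continuous_snd.clm_apply (h'.clm_apply continuous_const)).clm_apply
    (h'.clm_apply continuous_const))

/-- There is a family of endomorphisms, tending to `1` as `m'` tends to a structure `m` with unit
`e`, that carries a unit of `m'` to `e`. -/
theorem exists_tendsto_one_apply_unit_eq {e : V} {m : Bilin 𝕜 V} (hm : HasUnit m e) :
    ∃ T : Bilin 𝕜 V → V →L[𝕜] V, Filter.Tendsto T (𝓝 m) (𝓝 1) ∧
      ∀ᶠ m' in 𝓝 m, IsAssoc m' → ∃ e', HasUnit m' e' ∧ T m' e' = e := by
  have : CompleteSpace V := FiniteDimensional.complete 𝕜 V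
  -- If `e = 0`, then `V` is trivial, since `e` is a unit.
  by_cases he : e = 0
  · have hV : ∀ x : V, x = 0 := fun x => by
      rw [← (hm x).1, he]
      simp
    exact ⟨fun _ => 1, tendsto_const_nhds, .of_forall fun m' _ =>
      ⟨0, fun x => by simp [hV x], by simp [he]⟩⟩
  obtain ⟨φ, hφ⟩ := SeparatingDual.exists_eq_one (R := 𝕜) he
  have hme : m e = 1 := by
    ext x
    exact (hm x).1
  have hme' : m.flip e = 1 := by
    ext x
    exact (hm x).2
  have hLc : Filter.Tendsto (fun m' : Bilin 𝕜 V => m' e) (𝓝 m) (𝓝 1) := by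
    have : Continuous fun m' : Bilin 𝕜 V => m' e := by fun_prop
    exact hme ▸ this.tendsto m
  have hRc : Filter.Tendsto (fun m' : Bilin 𝕜 V => m'.flip e) (𝓝 m) (𝓝 1) := by
    have : Continuous fun m' : Bilin 𝕜 V => m'.flip e :=
      continuous_clm_apply.2 fun x => by
        simp only [ContinuousLinearMap.flip_apply]
        fun_prop
    exact hme' ▸ this.tendsto m
  have hunits : ∀ᶠ u : V →L[𝕜] V in 𝓝 1, IsUnit u := Units.nhds 1
  let E : Bilin 𝕜 V → V := fun m' => Ring.inverse (m' e) e
  have hE : Filter.Tendsto E (𝓝 m) (𝓝 e) := by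
    have h1 : Filter.Tendsto (Ring.inverse : (V →L[𝕜] V) → V →L[𝕜] V) (𝓝 1) (𝓝 1) := by
      simpa [ContinuousAt] using NormedRing.inverse_continuousAt (1 : (V →L[𝕜] V)ˣ)
    have h2 : Continuous fun u : V →L[𝕜] V => u e := by fun_prop
    exact (h2.tendsto 1).comp (h1.comp hLc)
  have hφE : Filter.Tendsto (fun m' => φ (E m')) (𝓝 m) (𝓝 1) :=
    hφ ▸ (φ.continuous.tendsto e).comp hE
  have hφne : ∀ᶠ m' in 𝓝 m, φ (E m') ≠ 0 := hφE.eventually_ne one_ne_zero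
  refine ⟨fun m' => 1 + φ.smulRight ((φ (E m'))⁻¹ • (e - E m')), ?_, ?_⟩
  · have h1 : Filter.Tendsto (fun m' => (φ (E m'))⁻¹ • (e - E m')) (𝓝 m) (𝓝 0) := by
      simpa using (hφE.inv₀ one_ne_zero).smul ((tendsto_const_nhds (x := e)).sub hE)
    have h2 : Continuous fun a : V => (1 + φ.smulRight a : V →L[𝕜] V) :=
      continuous_clm_apply.2 fun x => by
        simp only [add_apply, ContinuousLinearMap.smulRight_apply]
        fun_prop
    simpa [Function.comp_def] using (h2.tendsto 0).comp h1
  · filter_upwards [hLc.eventually hunits, hRc.eventually hunits, hφne] with m' hl hr hne hassoc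
    refine ⟨E m', hassoc.hasUnit_inverse hl hr, ?_⟩
    simp [smul_smul, hne]

/-- Structures near a structure `m` with unit `e` are moved by `GL(V)₀` to structures with unit `e`
that are as close to `m` as desired. -/
theorem eventually_exists_transport {e : V} (m : Unital 𝕜 e) {O : Set (Unital 𝕜 e)}
    (hO : O ∈ 𝓝 m) :
    ∀ᶠ m' : Assoc 𝕜 V in 𝓝 m.toAssoc,
      ∃ g ∈ glZero 𝕜 V, ∃ u ∈ O, transport g m'.1 = u.1 := by
  have : CompleteSpace V := FiniteDimensional.complete 𝕜 V
  obtain ⟨O', hO', hOO'⟩ := mem_nhds_subtype _ m O |>.1 hO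
  have hcont : Filter.Tendsto (fun p : GLin 𝕜 V × Bilin 𝕜 V => transport p.1 p.2)
      (𝓝 1 ×ˢ 𝓝 m.1) (𝓝 m.1) := by
    have := (continuous_transport (𝕜 := 𝕜) (V := V)).tendsto (1, m.1)
    rwa [transport_one, nhds_prod_eq] at this
  obtain ⟨A, hA, B, hB, hAB⟩ := Filter.mem_prod_iff.1 (hcont hO')
  obtain ⟨T, hT, hTe⟩ := exists_tendsto_one_apply_unit_eq m.2.2
  have hval : Units.val '' (A ∩ glZero 𝕜 V) ∈ 𝓝 (1 : V →L[𝕜] V) := by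
    have := Units.isOpenEmbedding_val.map_nhds_eq (1 : GLin 𝕜 V)
    rw [Units.val_one] at this
    rw [← this]
    exact Filter.image_mem_map (Filter.inter_mem hA glZero_mem_nhds_one)
  have hsub : Filter.Tendsto (Subtype.val : Assoc 𝕜 V → Bilin 𝕜 V) (𝓝 m.toAssoc) (𝓝 m.1) :=
    continuous_subtype_val.tendsto m.toAssoc
  filter_upwards [hsub hB, hsub.eventually (hT hval), hsub.eventually hTe] with m' hm'B hm'T hm'e
  obtain ⟨g, ⟨hgA, hg⟩, hgT⟩ := hm'T
  obtain ⟨e', he', hTe'⟩ := hm'e m'.2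
  have hunit : HasUnit (transport g m'.1) e := by
    have := he'.transport g
    rwa [hgT, hTe'] at this
  refine ⟨g, hg, ⟨transport g m'.1, m'.2.transport g, hunit⟩, hOO' ?_, rfl⟩
  exact hAB (Set.mk_mem_prod hgA hm'B)

theorem isOpenMap_forgetUnit (e : V) : IsOpenMap (forgetUnit 𝕜 e) := by
  intro U hU
  rw [← isQuotientMap_quotient_mk'.isOpen_preimage, isOpen_iff_mem_nhds]
  rintro a ⟨q, hq, hqa⟩
  obtain ⟨u, rfl⟩ := Quotient.exists_rep q
  obtain ⟨g, hg, hga⟩ := Quotient.exact hqa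
  -- The local statement holds at `u`; it is moved to `a = g • u` by the homeomorphism `g`.
  let τ : Assoc 𝕜 V → Assoc 𝕜 V := fun a' => ⟨transport g⁻¹ a'.1, a'.2.transport g⁻¹⟩
  have hτ : Continuous τ := Continuous.subtype_mk
    (continuous_transport.comp (continuous_const.prodMk continuous_subtype_val)) _
  have hτa : τ a = u.toAssoc := Subtype.ext (by
    change transport g⁻¹ a.1 = u.1
    rw [← hga, ← transport_mul, inv_mul_cancel, transport_one]
    rfl)
  have hloc := eventually_exists_transport u
    ((hU.preimage continuous_quotient_mk').mem_nhds hq)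
  rw [← hτa] at hloc
  filter_upwards [hτ.continuousAt.eventually hloc] with a' ⟨k, hk, u', hu', hku⟩
  refine ⟨Quotient.mk _ u', hu', Quotient.sound ((assocSetoid 𝕜 V).symm ?_)⟩
  exact ⟨k * g⁻¹, mul_mem hk (inv_mem hg), by rw [transport_mul]; exact hku⟩

end AlgStr

end

theorem mainTheorem3 {𝕜 : Type*} [RCLike 𝕜] {V : Type*} [NormedAddCommGroup V] [NormedSpace 𝕜 V]
    [FiniteDimensional 𝕜 V] (e : V) (m : AlgStr.Unital 𝕜 e) :
    (∀ᶠ m' : AlgStr.Assoc 𝕜 V in 𝓝 m.toAssoc,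
      (∃ e' : V, AlgStr.HasUnit m'.1 e') ∧
        ∃ g ∈ AlgStr.glZero 𝕜 V, AlgStr.HasUnit (AlgStr.transport g m'.1) e) ∧
    (∀ N ∈ 𝓝 (Quotient.mk (AlgStr.unitalSetoid 𝕜 e) m),
      ∃ (U : Set (AlgStr.UnitalClass 𝕜 e)) (W : Set (AlgStr.AssocClass 𝕜 V)),
        IsOpen U ∧ Quotient.mk (AlgStr.unitalSetoid 𝕜 e) m ∈ U ∧ U ⊆ N ∧
        IsOpen W ∧ Quotient.mk (AlgStr.assocSetoid 𝕜 V) m.toAssoc ∈ W ∧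
        Set.BijOn (AlgStr.forgetUnit 𝕜 e) U W) := by
  constructor
  · filter_upwards [AlgStr.eventually_exists_transport m Filter.univ_mem] with m' ⟨g, hg, u, _, hu⟩
    have hunit : AlgStr.HasUnit (AlgStr.transport g m'.1) e := hu ▸ u.2.2
    have hback := hunit.transport g⁻¹
    rw [← AlgStr.transport_mul, inv_mul_cancel, AlgStr.transport_one] at hback
    exact ⟨⟨_, hback⟩, g, hg, hunit⟩
  · intro N hN
    obtain ⟨U, hUN, hU, hmU⟩ := mem_nhds_iff.1 hN
    exact ⟨U, AlgStr.forgetUnit 𝕜 e '' U, hU, hmU, hUN, AlgStr.isOpenMap_forgetUnit e U hU,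
      ⟨_, hmU, rfl⟩, (AlgStr.forgetUnit_injective e).injOn.bijOn_image⟩
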